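/- Let $a>1$, $b\in(0,a-1)$, and let $\mathsf E=[1,\infty)$. Let $\nu$ be the measure on $\mathsf E$ with Lebesgue density $(a-1)x^{-a}$, put $w(x)=x^{-b}$, and let $$P(x,\cdot)=w(x)\,\nu(\cdot)+(1-w(x))\,\delta_x(\cdot),\qquad \mu(\mathrm dx)=\frac{w(x)^{-1}\,\nu(\mathrm dx)}{\nu(w^{-1})}.$$ Then $\nu$ and $\mu$ are probability measures, $P$ is a Markov kernel, $\mu$ has Lebesgue density $(a-b-1)x^{-(a-b)}$ on $\mathsf E$, and $P$ is $\mu$-reversible. Moreover: 1. For every real $s<\frac{a-b-1}{b}$ and every $x\in\mathsf E$, $$n^{s}\,\bigl\|P^n(x,\cdot)-\mu\bigr\|_{\mathrm{TV}}\to0\quad\text{as } n\to\infty .$$ 2. For every real $s$, $$\sup_{n\ge1}\; n^{s}\,\sup\bigl\{\|P^nf\|_{L^2(\mu)} : f\in L^2(\mu),\ \mu(f)=0,\ \|f\|_{\mathrm{osc}}=1\bigr\}<\infty\quad\text{if and only if}\quad s\le\frac{a-b-1}{2b}.$$ Here $\|\rho_1-\rho_2\|_{\mathrm{TV}}=\frac12\sup\{\rho_1(f)-\rho_2(f):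 f \text{ measurable},\ |f|\le1\}$ for probability measures $\rho_1,\rho_2$, and $\|f\|_{\mathrm{osc}}=\operatorname{ess\,sup}_\mu f-\operatorname{ess\,inf}_\mu f$. -/

import Mathlib

open MeasureTheory ProbabilityTheory Filter Topology
open scoped ENNReal

namespace ParetoChain

/-- The state space `[1, ∞)`, with its Borel σ-algebra. -/
abbrev E : Type := Set.Ici (1 : ℝ)

/-- Lebesgue measure on `[1, ∞)`. -/
noncomputable def lebesgue : Measure E := (volume : Measure ℝ).comap Subtype.val

/-- The Pareto law with density `(a - 1) / x ^ a` on `[1, ∞)`. -/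
noncomputable def nu (a : ℝ) : Measure E :=
  lebesgue.withDensity fun x => ENNReal.ofReal ((a - 1) / (x : ℝ) ^ a)

/-- The refreshment probability `w(x) = x ^ (-b)`. -/
noncomputable def w (b : ℝ) (x : E) : ℝ := (x : ℝ) ^ (-b)

theorem measurable_w (b : ℝ) : Measurable (w b) := by
  unfold w
  fun_prop

/-- The kernel `P(x, ·) = w(x) ν(·) + (1 - w(x)) δ_x(·)`. -/
noncomputable def P (a b : ℝ) : Kernel E E where
  toFun x := ENNReal.ofReal (w b x) • nu a + ENNReal.ofReal (1 - w b x) • Measure.dirac x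
  measurable' := by
    refine Measure.measurable_of_measurable_coe _ fun s hs => ?_
    have h1 : Measurable fun x : E => Measure.dirac x s :=
      (Measure.measurable_coe hs).comp Measure.measurable_dirac
    have h2 := measurable_w b
    simp only [Measure.add_apply, Measure.smul_apply, smul_eq_mul]
    fun_prop

/-- The law `μ(dx) = w(x)⁻¹ ν(dx) / ν(w⁻¹)`. -/
noncomputable def mu (a b : ℝ) : Measure E :=
  (∫⁻ x, ENNReal.ofReal (w b x)⁻¹ ∂nu a)⁻¹ •
    (nu a).withDensity fun x => ENNReal.ofReal (w b x)⁻¹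

/-- Total variation distance between probability measures,
`(1/2) sup {ρ₁(f) - ρ₂(f) : f measurable, |f| ≤ 1}`. The value of the supremum is unaffected by
`ENNReal.ofReal`, since `f = 0` competes. -/
noncomputable def tvDist {X : Type*} [MeasurableSpace X] (ρ₁ ρ₂ : Measure X) : ℝ≥0∞ :=
  (⨆ f ∈ {f : X → ℝ | Measurable f ∧ ∀ y, |f y| ≤ 1},
    ENNReal.ofReal (∫ y, f y ∂ρ₁ - ∫ y, f y ∂ρ₂)) / 2

/-- The essential oscillation `ess sup f - ess inf f`, computed in the extended reals so that
it is infinite when `f` is essentially unbounded. -/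
noncomputable def essOsc {X : Type*} [MeasurableSpace X] (μ : Measure X) (f : X → ℝ) : EReal :=
  essSup (fun x => (f x : EReal)) μ - essInf (fun x => (f x : EReal)) μ

/-- Representatives of the `f ∈ L²₀(μ)` with `‖f‖_osc = 1`. -/
def unitOsc {X : Type*} [MeasurableSpace X] (μ : Measure X) : Set (X → ℝ) :=
  {f | MemLp f 2 μ ∧ ∫ x, f x ∂μ = 0 ∧ essOsc μ f = 1}

/-- `sup {‖Qf‖₂ : f ∈ L²₀(μ), ‖f‖_osc = 1}`, where `Qf(x) = ∫ f(y) Q(x, dy)`. -/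
noncomputable def oscToL2 {X : Type*} [MeasurableSpace X] (μ : Measure X) (Q : Kernel X X) :
    ℝ≥0∞ :=
  ⨆ f ∈ unitOsc μ, eLpNorm (fun x => ∫ y, f y ∂(Q x)) 2 μ

end ParetoChain

/-! The chain regenerates: each refreshment starts a new tour from `ν`. Under `ν` a tour outlasts
`n` steps with probability `G n = ν((1-w)^n)` (`holdMoment`), and `m = ∑ G n = ν(1/w)` is the mean
tour length. Write `κ = (a-b-1)/b`. Since `w` has power tails, `G n = O(n^(-κ-1))`. As `μ` is again
Pareto, with exponent `a-b`, the same estimate gives `μ((1-w)^n) = O(n^(-κ))`.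

Being a moment sequence, `G` is log-convex, so by Kaluza's theorem the renewal sequence `u`
decreases, and it stays above `1/m`. The renewal error is therefore a sum with nonnegative weights,
and it equals the integrated tail `1 - m⁻¹ ∑_{l ≤ n} G l = μ((1-w)^(n+1))`. This gives `|νPⁿf -
μ(f)| ≤ 2 μ((1-w)^(n+1))` for `|f| ≤ 1` (`abs_renewal_sub_le`, `abs_integral_iter_sub_le`).

Conditioning on the first refreshment from `x` turns this into the pointwise bound `deviation`. For
fixed `x` the waiting time is geometric, so total variation is `O(n^(-κ))`. Under `μ` the waiting
time has weights `G j / m`, so `∫ deviation dμ` is also `O(n^(-κ))`. A centred `f` of unit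
oscillation has `|Pⁿf| ≤ 1` almost everywhere, so `‖Pⁿf‖₂² ≤ ∫ deviation dμ`, which gives the
exponent `κ/2`.

That exponent is sharp (`le_oscToL2`): from points with `w ≤ 1/(2n)`, a set of `μ`-mass `(2n)^(-κ)`,
no refreshment occurs by time `n` with probability at least `1/2`. -/

namespace ParetoChain

/-! ### Renewal sequences of log-convex tails. -/

section Renewal

variable {G u : ℕ → ℝ}

theorem ratio_monotone (hpos : ∀ n, 0 < G n) (hlc : ∀ n, G (n + 1) ^ 2 ≤ G n * G (n + 2)) :
    Monotone fun n => G (n + 1) / G n := by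
  refine monotone_nat_of_le_succ fun n => ?_
  rw [div_le_div_iff₀ (hpos n) (hpos (n + 1))]
  nlinarith [hlc n]

/-- Kaluza's theorem: the renewal sequence of a log-convex tail is decreasing. -/
theorem renewal_antitone (hpos : ∀ n, 0 < G n) (h0 : G 0 = 1)
    (hlc : ∀ n, G (n + 1) ^ 2 ≤ G n * G (n + 2))
    (hu : ∀ n, ∑ k ∈ Finset.range (n + 1), u k * G (n - k) = 1) : Antitone u := by
  have hu0 : u 0 = 1 := by simpa [h0] using hu 0
  have hconv (n : ℕ) :
      ∑ k ∈ Finset.range (n + 1), (u k - u (k + 1)) * G (n - k) = G (n + 1) := by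
    have h1 := hu (n + 1)
    rw [Finset.sum_range_succ'] at h1
    simp only [Nat.add_sub_add_right, Nat.sub_zero, hu0, one_mul] at h1
    have h2 := hu n
    simp only [sub_mul, Finset.sum_sub_distrib]
    linarith
  have hnonneg (n : ℕ) : 0 ≤ u n - u (n + 1) := by
    induction n using Nat.strong_induction_on with
    | _ n ih =>
      rcases n with _ | n
      · have := hconv 0
        simp only [zero_add, Finset.range_one, Finset.sum_singleton, Nat.sub_zero, h0] at this
        have := hpos 1
        simp only [zero_add]
        linarith
      · have h1 := hconv (n + 1)
        rw [Finset.sum_range_succ, Nat.sub_self, h0, mul_one] at h1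
        -- Ratios of `G` increase, so moving one index forward costs at most the last ratio. By
        -- `hconv n` the right side is `G (n + 2)`, which leaves a nonnegative remainder for the new
        -- difference.
        have h2 : ∑ k ∈ Finset.range (n + 1), (u k - u (k + 1)) * G (n + 1 - k) ≤
            G (n + 2) / G (n + 1) *
              ∑ k ∈ Finset.range (n + 1), (u k - u (k + 1)) * G (n - k) := by
          rw [Finset.mul_sum]
          refine Finset.sum_le_sum fun k hk => ?_
          have hk' : k ≤ n := Nat.lt_succ_iff.mp (Finset.mem_range.mp hk)
          have h3 : G (n - k + 1) / G (n - k) ≤ G (n + 2) / G (n + 1) :=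
            ratio_monotone hpos hlc (by omega : n - k ≤ n + 1)
          rw [div_le_iff₀ (hpos _)] at h3
          rw [show n + 1 - k = n - k + 1 by omega]
          nlinarith [mul_le_mul_of_nonneg_left h3 (ih k (by omega))]
        rw [hconv n, div_mul_cancel₀ _ (hpos _).ne'] at h2
        linarith
  exact antitone_nat_of_succ_le fun n => by linarith [hnonneg n]

/-- Split the renewal identity at time `N + n` into `k < N`, where `u k ≤ 1` and the tails vanish as
`n → ∞`, and `k ≥ N`, where `u k ≤ u N`. -/
theorem one_le_renewal_mul {m : ℝ} (hpos : ∀ n, 0 < G n) (hu0 : u 0 = 1)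
    (hanti : Antitone u) (hu : ∀ n, ∑ k ∈ Finset.range (n + 1), u k * G (n - k) = 1)
    (hm : HasSum G m) (N : ℕ) : 1 ≤ u N * m := by
  have hG : Tendsto G atTop (𝓝 0) := hm.summable.tendsto_atTop_zero
  have hlim : Tendsto (fun n => ∑ k ∈ Finset.range N, G (n + (N - k)) +
      u N * ∑ l ∈ Finset.range (n + 1), G l) atTop (𝓝 (∑ k ∈ Finset.range N, (0 : ℝ) + u N * m)) := by
    refine Tendsto.add (tendsto_finsetSum _ fun k _ => ?_) (Tendsto.const_mul _ ?_)
    · exact (tendsto_add_atTop_iff_nat (N - k)).2 hG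
    · exact (tendsto_add_atTop_iff_nat 1).2 hm.tendsto_sum_nat
  simp only [Finset.sum_const_zero, zero_add] at hlim
  refine ge_of_tendsto' hlim fun n => ?_
  rw [← hu (N + n), add_assoc, Finset.sum_range_add, ← Finset.sum_range_reflect G, Finset.mul_sum]
  refine add_le_add (Finset.sum_le_sum fun k hk => ?_) (Finset.sum_le_sum fun k hk => ?_)
  · have := Finset.mem_range.mp hk
    rw [show N + n - k = n + (N - k) by omega]
    have h1 : u k ≤ 1 := hu0 ▸ hanti (Nat.zero_le k)
    nlinarith [hpos (n + (N - k))]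
  · rw [show N + n - (N + k) = n + 1 - 1 - k by omega]
    exact mul_le_mul_of_nonneg_right (hanti (Nat.le_add_right _ _)) (hpos _).le

-- In generating functions `U = 1 / ((1 - X) G)`. The step law `G j - G (j + 1)`, delayed by one,
-- has series `1 - (1 - X) G`, so the renewal equation reads `(1 - X) G g = φ`, that is `g = U φ`.
open PowerSeries in
theorem exists_renewal (h0 : G 0 = 1) : ∃ u : ℕ → ℝ,
    (∀ n, ∑ k ∈ Finset.range (n + 1), u k * G (n - k) = 1) ∧
    ∀ φ g : ℕ → ℝ, (∀ n, g n = φ n + ∑ j ∈ Finset.range n, (G j - G (j + 1)) * g (n - 1 - j)) →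
      ∀ n, g n = ∑ k ∈ Finset.range (n + 1), u k * φ (n - k) := by
  have hne : PowerSeries.constantCoeff (PowerSeries.mk G) ≠ 0 := by simp [h0]
  have hGG : (PowerSeries.mk G)⁻¹ * PowerSeries.mk G = 1 := PowerSeries.inv_mul_cancel _ hne
  set U : PowerSeries ℝ := (PowerSeries.mk 1) * (PowerSeries.mk G)⁻¹ with hU
  have hUG : U * PowerSeries.mk G = PowerSeries.mk 1 := by rw [hU, mul_assoc, hGG, mul_one]
  refine ⟨fun k => PowerSeries.coeff k U, fun n => ?_, fun φ g hg n => ?_⟩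
  · have := congrArg (PowerSeries.coeff n) hUG
    rw [PowerSeries.coeff_mul, Finset.Nat.sum_antidiagonal_eq_sum_range_succ_mk] at this
    simpa using this
  · have key : PowerSeries.mk g = PowerSeries.mk φ +
        (1 - (1 - PowerSeries.X) * PowerSeries.mk G) * PowerSeries.mk g := by
      have hD : (1 - (1 - PowerSeries.X) * PowerSeries.mk G : PowerSeries ℝ) =
          PowerSeries.X * PowerSeries.mk fun j => G j - G (j + 1) := by
        ext n
        rcases n with _ | n
        · simp [h0]
        · rw [sub_mul, one_mul]
          simp [PowerSeries.coeff_succ_X_mul, PowerSeries.coeff_one]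
      rw [hD, mul_assoc]
      ext n
      rcases n with _ | n
      · simpa using hg 0
      · rw [map_add, PowerSeries.coeff_succ_X_mul, PowerSeries.coeff_mul,
          Finset.Nat.sum_antidiagonal_eq_sum_range_succ_mk]
        simpa using hg (n + 1)
    have key2 : PowerSeries.mk g = U * PowerSeries.mk φ := by
      have h1 : U * ((1 - PowerSeries.X) * PowerSeries.mk G) = 1 := by
        rw [mul_left_comm, hUG, mul_comm, PowerSeries.mk_one_mul_one_sub_eq_one]
      have h2 : (1 - PowerSeries.X) * PowerSeries.mk G * PowerSeries.mk g = PowerSeries.mk φ := by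
        linear_combination key
      rw [← h2, ← mul_assoc, h1, one_mul]
    have := congrArg (PowerSeries.coeff n) key2
    rw [PowerSeries.coeff_mul, Finset.Nat.sum_antidiagonal_eq_sum_range_succ_mk] at this
    simpa using this

/-- Explicit rate in the renewal theorem for log-convex tails. -/
theorem abs_renewal_sub_le {m L : ℝ} (hpos : ∀ n, 0 < G n) (h0 : G 0 = 1)
    (hlc : ∀ n, G (n + 1) ^ 2 ≤ G n * G (n + 2)) (hm : HasSum G m) {φ g : ℕ → ℝ}
    (hφ : ∀ n, |φ n| ≤ G n)
    (hg : ∀ n, g n = φ n + ∑ j ∈ Finset.range n, (G j - G (j + 1)) * g (n - 1 - j)) (n : ℕ)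
    (hL : |m⁻¹ * ∑ l ∈ Finset.range (n + 1), φ l - L| ≤
      1 - m⁻¹ * ∑ l ∈ Finset.range (n + 1), G l) :
    |g n - L| ≤ 2 * (1 - m⁻¹ * ∑ l ∈ Finset.range (n + 1), G l) := by
  obtain ⟨u, hu, hsol⟩ := exists_renewal h0
  have hanti := renewal_antitone hpos h0 hlc hu
  have hm0 : 0 < m := (hpos 0).trans_le (le_hasSum hm 0 fun i _ => (hpos i).le)
  have hv (k : ℕ) : 0 ≤ u k - m⁻¹ := by
    have := one_le_renewal_mul hpos (by simpa [h0] using hu 0) hanti hu hm k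
    rw [sub_nonneg, inv_le_iff_one_le_mul₀ hm0]
    exact this
  have hrefl (ψ : ℕ → ℝ) : ∑ k ∈ Finset.range (n + 1), (u k - m⁻¹) * ψ (n - k) =
      ∑ k ∈ Finset.range (n + 1), u k * ψ (n - k) - m⁻¹ * ∑ l ∈ Finset.range (n + 1), ψ l := by
    rw [← Finset.sum_range_reflect ψ, Finset.mul_sum, ← Finset.sum_sub_distrib]
    exact Finset.sum_congr rfl fun k _ => by rw [sub_mul, show n + 1 - 1 - k = n - k by omega]
  -- The weights `u k - m⁻¹` are nonnegative, so `|φ|` may be replaced by `G`, for which the sum is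
  -- explicit.
  have h1 : |∑ k ∈ Finset.range (n + 1), (u k - m⁻¹) * φ (n - k)| ≤
      1 - m⁻¹ * ∑ l ∈ Finset.range (n + 1), G l := by
    rw [← hu n, ← hrefl G]
    refine (Finset.abs_sum_le_sum_abs _ _).trans (Finset.sum_le_sum fun k _ => ?_)
    rw [abs_mul, abs_of_nonneg (hv k)]
    exact mul_le_mul_of_nonneg_left (hφ _) (hv k)
  have h2 : g n - L = ∑ k ∈ Finset.range (n + 1), (u k - m⁻¹) * φ (n - k) +
      (m⁻¹ * ∑ l ∈ Finset.range (n + 1), φ l - L) := by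
    rw [hrefl φ, hsol φ g hg n]
    ring
  rw [h2]
  refine (abs_add_le _ _).trans ?_
  linarith

end Renewal

/-! ### Convolution and comparison of power rates. -/

/-- Convolving a summable power decay with a slower one preserves the slower rate. -/
theorem exists_convolution_bound {κ : ℝ} (hκ : 0 < κ) : ∃ K : ℝ, 0 ≤ K ∧ ∀ n : ℕ, 1 ≤ n →
    ∑ j ∈ Finset.range n, ((j : ℝ) + 1) ^ (-κ - 1) * ((n - 1 - j : ℕ) + 1 : ℝ) ^ (-κ) ≤
      K * (n : ℝ) ^ (-κ) := by
  have hsum : Summable fun j : ℕ => ((j : ℝ) + 1) ^ (-κ - 1) := by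
    have := (summable_nat_add_iff 1).2 (Real.summable_nat_rpow.2 (by linarith : -κ - 1 < -1))
    simpa using this
  have hS : 0 ≤ ∑' j : ℕ, ((j : ℝ) + 1) ^ (-κ - 1) := tsum_nonneg fun j => by positivity
  refine ⟨2 ^ κ * (∑' j : ℕ, ((j : ℝ) + 1) ^ (-κ - 1) + 2), by positivity, fun n hn => ?_⟩
  have hn0 : (0 : ℝ) < n := by exact_mod_cast hn
  -- If `n - j ≥ n/2`, the second factor is at most `(n/2)^(-κ)`. Otherwise `j + 1 ≥ n/2`, and the
  -- first is at most `(n/2)^(-κ) * (2/n)`. Summed over `n` terms, `2/n` contributes the constant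
  -- `2`.
  have hterm (j : ℕ) (hj : j ∈ Finset.range n) :
      ((j : ℝ) + 1) ^ (-κ - 1) * ((n - 1 - j : ℕ) + 1 : ℝ) ^ (-κ) ≤
        2 ^ κ * (n : ℝ) ^ (-κ) * (((j : ℝ) + 1) ^ (-κ - 1) + 2 / n) := by
    have hj' := Finset.mem_range.mp hj
    have hcast : ((n - 1 - j : ℕ) + 1 : ℝ) = n - j := by
      rw [show n - 1 - j = n - (j + 1) by omega, Nat.cast_sub (by omega)]
      push_cast
      ring
    have hhalf : (2 : ℝ) ^ κ * (n : ℝ) ^ (-κ) = ((n : ℝ) / 2) ^ (-κ) := by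
      rw [Real.div_rpow hn0.le zero_le_two, Real.rpow_neg zero_le_two, div_inv_eq_mul, mul_comm]
    have hjn : (j : ℝ) + 1 ≤ n := by exact_mod_cast hj'
    rw [hcast, hhalf, mul_add]
    rcases le_total ((n : ℝ) / 2) (n - j) with h | h
    · have h1 : ((n : ℝ) - j) ^ (-κ) ≤ ((n : ℝ) / 2) ^ (-κ) :=
        Real.rpow_le_rpow_of_nonpos (by positivity) h (by linarith)
      have h2 : (0 : ℝ) ≤ ((n : ℝ) / 2) ^ (-κ) * (2 / n) := by positivity
      have h3 : (0 : ℝ) ≤ ((j : ℝ) + 1) ^ (-κ - 1) := by positivity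
      nlinarith
    · have h1 : ((j : ℝ) + 1) ^ (-κ - 1) ≤ ((n : ℝ) / 2) ^ (-κ) * (2 / n) := by
        have : ((n : ℝ) / 2) ^ (-κ) * (2 / n) = ((n : ℝ) / 2) ^ (-κ - 1) := by
          rw [Real.rpow_sub_one (by positivity)]
          field_simp
        rw [this]
        exact Real.rpow_le_rpow_of_nonpos (by positivity) (by linarith) (by linarith)
      have h2 : ((n : ℝ) - j) ^ (-κ) ≤ 1 :=
        Real.rpow_le_one_of_one_le_of_nonpos (by linarith) (by linarith)
      have h3 : (0 : ℝ) ≤ ((j : ℝ) + 1) ^ (-κ - 1) := by positivity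
      have h4 : (0 : ℝ) ≤ ((n : ℝ) / 2) ^ (-κ) * ((j : ℝ) + 1) ^ (-κ - 1) := by positivity
      nlinarith
  refine (Finset.sum_le_sum hterm).trans ?_
  rw [← Finset.mul_sum, Finset.sum_add_distrib, Finset.sum_const, Finset.card_range, nsmul_eq_mul,
    mul_div_cancel₀ _ hn0.ne']
  have : ∑ j ∈ Finset.range n, ((j : ℝ) + 1) ^ (-κ - 1) ≤ ∑' j : ℕ, ((j : ℝ) + 1) ^ (-κ - 1) :=
    hsum.sum_le_tsum _ fun j _ => by positivity
  calc _ ≤ 2 ^ κ * (n : ℝ) ^ (-κ) * (∑' j : ℕ, ((j : ℝ) + 1) ^ (-κ - 1) + 2) := by gcongr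
    _ = _ := by ring

theorem convolution_le {κ K A B : ℝ} {α r : ℕ → ℝ} {n : ℕ} (hA : 0 ≤ A)
    (hK : ∑ j ∈ Finset.range n, ((j : ℝ) + 1) ^ (-κ - 1) * ((n - 1 - j : ℕ) + 1 : ℝ) ^ (-κ) ≤
      K * (n : ℝ) ^ (-κ)) (hB : 0 ≤ B)
    (hα : ∀ j : ℕ, α j ≤ A * ((j : ℝ) + 1) ^ (-κ - 1)) (hr0 : ∀ j, 0 ≤ r j)
    (hr : ∀ j : ℕ, r j ≤ B * ((j : ℝ) + 1) ^ (-κ)) :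
    ∑ j ∈ Finset.range n, α j * r (n - 1 - j) ≤ A * B * K * (n : ℝ) ^ (-κ) := by
  calc ∑ j ∈ Finset.range n, α j * r (n - 1 - j)
      ≤ ∑ j ∈ Finset.range n, A * B *
        (((j : ℝ) + 1) ^ (-κ - 1) * ((n - 1 - j : ℕ) + 1 : ℝ) ^ (-κ)) := by
        refine Finset.sum_le_sum fun j _ => ?_
        calc α j * r (n - 1 - j) ≤ A * ((j : ℝ) + 1) ^ (-κ - 1) * r (n - 1 - j) :=
              mul_le_mul_of_nonneg_right (hα j) (hr0 _)
          _ ≤ A * ((j : ℝ) + 1) ^ (-κ - 1) * (B * ((n - 1 - j : ℕ) + 1 : ℝ) ^ (-κ)) :=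
              mul_le_mul_of_nonneg_left (hr _) (by positivity)
          _ = _ := by ring
    _ ≤ A * B * (K * (n : ℝ) ^ (-κ)) := by
        rw [← Finset.mul_sum]
        exact mul_le_mul_of_nonneg_left hK (by positivity)
    _ = _ := by ring

/-- Geometric sequences decay faster than any power. -/
theorem exists_pow_le_rpow {q : ℝ} (h0 : 0 ≤ q) (h1 : q < 1) (p : ℝ) :
    ∃ A : ℝ, 0 ≤ A ∧ ∀ n : ℕ, q ^ n ≤ A * ((n : ℝ) + 1) ^ (-p) := by
  obtain ⟨k, hk⟩ := exists_nat_ge p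
  have hlim : Tendsto (fun n : ℕ => ((n + 1 : ℕ) : ℝ) ^ k * q ^ (n + 1)) atTop (𝓝 0) :=
    (tendsto_add_atTop_iff_nat 1).2
      (tendsto_pow_const_mul_const_pow_of_abs_lt_one k (by rwa [abs_of_nonneg h0]))
  obtain ⟨A, hA⟩ := hlim.bddAbove_range
  rcases h0.eq_or_lt with rfl | hq
  · refine ⟨1, zero_le_one, fun n => ?_⟩
    rcases n with _ | n
    · simp
    · rw [zero_pow (by omega)]
      positivity
  refine ⟨A / q, div_nonneg (le_trans (by positivity) (hA ⟨0, rfl⟩)) h0, fun n => ?_⟩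
  have h2 : ((n + 1 : ℕ) : ℝ) ^ k * q ^ (n + 1) ≤ A := hA ⟨n, rfl⟩
  have h3 : ((n : ℝ) + 1) ^ p ≤ ((n : ℝ) + 1) ^ k := by
    rw [← Real.rpow_natCast]
    exact Real.rpow_le_rpow_of_exponent_le (by linarith [n.cast_nonneg (α := ℝ)]) hk
  rw [Real.rpow_neg (by positivity), ← div_eq_mul_inv, le_div_iff₀ (by positivity),
    le_div_iff₀ hq]
  calc q ^ n * ((n : ℝ) + 1) ^ p * q ≤ q ^ n * ((n : ℝ) + 1) ^ k * q := by gcongr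
    _ = ((n + 1 : ℕ) : ℝ) ^ k * q ^ (n + 1) := by push_cast; ring
    _ ≤ A := h2

/-! ### Pareto laws and moments of the holding probability. -/

section Pareto

variable {a b : ℝ}

theorem one_le_coe (x : E) : (1 : ℝ) ≤ x := x.2

theorem coe_pos (x : E) : (0 : ℝ) < x := zero_lt_one.trans_le x.2

theorem w_pos (b : ℝ) (x : E) : 0 < w b x := Real.rpow_pos_of_pos (coe_pos x) _

theorem w_le_one (hb : 0 < b) (x : E) : w b x ≤ 1 :=
  Real.rpow_le_one_of_one_le_of_nonpos (one_le_coe x) (by linarith)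

theorem measurable_density (a : ℝ) :
    Measurable fun x : E => ENNReal.ofReal ((a - 1) / (x : ℝ) ^ a) := by
  fun_prop

theorem density_nonneg (ha : 1 < a) (x : E) : 0 ≤ (a - 1) / (x : ℝ) ^ a :=
  div_nonneg (by linarith) (Real.rpow_nonneg (coe_pos x).le _)

theorem integral_nu (ha : 1 < a) (f : E → ℝ) :
    ∫ x, f x ∂nu a = ∫ x, (a - 1) / (x : ℝ) ^ a * f x ∂lebesgue := by
  rw [nu, integral_withDensity_eq_integral_toReal_smul (measurable_density a)
    (ae_of_all _ fun x => ENNReal.ofReal_lt_top)]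
  simp_rw [ENNReal.toReal_ofReal (density_nonneg ha _), smul_eq_mul]

theorem integral_lebesgue (f : ℝ → ℝ) :
    ∫ x : E, f x ∂lebesgue = ∫ x in Set.Ioi (1 : ℝ), f x := by
  rw [lebesgue, integral_subtype_comap measurableSet_Ici, integral_Ici_eq_integral_Ioi]

/-- The tail `{x : t ≤ x}` of the state space. -/
def tail (t : ℝ) : Set E := {x | t ≤ (x : ℝ)}

theorem measurableSet_tail (t : ℝ) : MeasurableSet (tail t) :=
  measurableSet_le measurable_const measurable_subtype_coe

theorem nu_tail (ha : 1 < a) {t : ℝ} (ht : 1 ≤ t) :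
    nu a (tail t) = ENNReal.ofReal (t ^ (-(a - 1))) := by
  have ht0 : 0 < t := by linarith
  rw [nu, withDensity_apply _ (measurableSet_tail t), lebesgue,
    setLIntegral_subtype measurableSet_Ici _ fun x : ℝ => ENNReal.ofReal ((a - 1) / x ^ a)]
  have himage : ((↑) '' tail t : Set ℝ) = Set.Ici t := by
    ext x
    simp only [tail, Set.mem_image, Set.mem_ofPred_eq, Set.mem_Ici]
    exact ⟨by rintro ⟨y, hy, rfl⟩; exact hy, fun hx => ⟨⟨x, ht.trans hx⟩, hx, rfl⟩⟩
  have hcongr : Set.EqOn (fun x : ℝ => (a - 1) / x ^ a) (fun x => (a - 1) * x ^ (-a))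
      (Set.Ioi t) := fun x hx => by
    simp only
    rw [Real.rpow_neg (ht0.trans hx).le, div_eq_mul_inv]
  rw [himage, setLIntegral_congr Ioi_ae_eq_Ici.symm, ← ofReal_integral_eq_lintegral_ofReal]
  · rw [setIntegral_congr_fun measurableSet_Ioi hcongr, integral_const_mul,
      integral_Ioi_rpow_of_lt (by linarith) ht0]
    congr 1
    rw [show -a + 1 = -(a - 1) by ring]
    field_simp [show a - 1 ≠ 0 by linarith]
  · exact IntegrableOn.congr_fun ((integrableOn_Ioi_rpow_of_lt (by linarith : -a < -1) ht0).const_mul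
      (a - 1)) hcongr.symm measurableSet_Ioi
  · filter_upwards [ae_restrict_mem measurableSet_Ioi] with x hx
    exact div_nonneg (by linarith) (Real.rpow_nonneg (ht0.trans hx).le _)

theorem tail_one : tail 1 = Set.univ := Set.eq_univ_of_forall fun x => x.2

theorem isProbabilityMeasure_nu (ha : 1 < a) : IsProbabilityMeasure (nu a) :=
  ⟨by rw [← tail_one, nu_tail ha le_rfl]; simp⟩

theorem one_sub_w_pow_nonneg (hb : 0 < b) (n : ℕ) (x : E) : 0 ≤ (1 - w b x) ^ n :=
  pow_nonneg (sub_nonneg.2 (w_le_one hb x)) n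

theorem one_sub_w_pow_le_one (hb : 0 < b) (n : ℕ) (x : E) : (1 - w b x) ^ n ≤ 1 :=
  pow_le_one₀ (sub_nonneg.2 (w_le_one hb x)) (by linarith [w_pos b x])

theorem integrable_of_bounded {X : Type*} [MeasurableSpace X] {μ : Measure X} [IsFiniteMeasure μ]
    {f : X → ℝ} (hf : Measurable f) (C : ℝ) (hC : ∀ x, |f x| ≤ C) : Integrable f μ :=
  Integrable.of_bound hf.aestronglyMeasurable C (ae_of_all _ hC)

theorem integrable_one_sub_w_pow_mul (hb : 0 < b) {ρ : Measure E} [IsFiniteMeasure ρ] (n : ℕ)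
    {f : E → ℝ} (hf : Measurable f) {C : ℝ} (hC : ∀ x, |f x| ≤ C) :
    Integrable (fun x => (1 - w b x) ^ n * f x) ρ := by
  refine integrable_of_bounded ?_ C fun x => ?_
  · have := measurable_w b
    fun_prop
  · rw [abs_mul, abs_of_nonneg (one_sub_w_pow_nonneg hb n x)]
    exact (mul_le_of_le_one_left (abs_nonneg _) (one_sub_w_pow_le_one hb n x)).trans (hC x)

theorem integrable_one_sub_w_pow (hb : 0 < b) {ρ : Measure E} [IsFiniteMeasure ρ] (n : ℕ) :
    Integrable (fun x => (1 - w b x) ^ n) ρ := by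
  simpa using integrable_one_sub_w_pow_mul hb (ρ := ρ) n (f := fun _ => 1) measurable_const
    (C := 1) (by simp)

/-- The `n`-th moment of the holding probability `1 - w` under the Pareto law `nu a`. -/
noncomputable def holdMoment (a b : ℝ) (n : ℕ) : ℝ := ∫ x, (1 - w b x) ^ n ∂nu a

theorem holdMoment_zero (ha : 1 < a) (b : ℝ) : holdMoment a b 0 = 1 := by
  have := isProbabilityMeasure_nu ha
  simp [holdMoment]

theorem holdMoment_nonneg (a : ℝ) (hb : 0 < b) (n : ℕ) : 0 ≤ holdMoment a b n :=
  integral_nonneg fun x => one_sub_w_pow_nonneg hb n x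

/-- Combine `1 - w ≤ exp (-w)` with `exp (-y) ≤ k! / y ^ k` at `y = (n + 1) w`; the factor `e` pays
for replacing `n` by `n + 1`. -/
theorem one_sub_w_pow_le (hb : 0 < b) (n k : ℕ) (x : E) :
    (1 - w b x) ^ n ≤ Real.exp 1 * k.factorial * ((n : ℝ) + 1) ^ (-(k : ℝ)) * (x : ℝ) ^ (b * k) := by
  have hw := w_pos b x
  have hx := coe_pos x
  have h1 : (1 - w b x) ^ n ≤ Real.exp 1 * Real.exp (-(((n : ℝ) + 1) * w b x)) := by
    calc (1 - w b x) ^ n ≤ Real.exp (-w b x) ^ n :=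
          pow_le_pow_left₀ (sub_nonneg.2 (w_le_one hb x)) (Real.one_sub_le_exp_neg _) n
      _ = Real.exp (-(n * w b x)) := by rw [← Real.exp_nat_mul]; ring_nf
      _ ≤ Real.exp (1 + -(((n : ℝ) + 1) * w b x)) := by
          apply Real.exp_le_exp.2
          linarith [w_le_one hb x]
      _ = _ := Real.exp_add _ _
  have h2 : Real.exp (-(((n : ℝ) + 1) * w b x)) ≤ k.factorial / (((n : ℝ) + 1) * w b x) ^ k := by
    have hy : 0 < ((n : ℝ) + 1) * w b x := by positivity
    have := Real.pow_div_factorial_le_exp _ hy.le k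
    rw [Real.exp_neg, inv_eq_one_div, div_le_div_iff₀ (Real.exp_pos _) (by positivity)]
    rw [div_le_iff₀ (by positivity)] at this
    linarith
  have h3 : (k.factorial : ℝ) / (((n : ℝ) + 1) * w b x) ^ k =
      k.factorial * ((n : ℝ) + 1) ^ (-(k : ℝ)) * (x : ℝ) ^ (b * k) := by
    rw [mul_pow, Real.rpow_neg (by positivity), Real.rpow_natCast, w, Real.rpow_neg hx.le,
      Real.rpow_mul hx.le, Real.rpow_natCast, inv_pow]
    field_simp
  calc _ ≤ _ := h1
    _ ≤ Real.exp 1 * _ := mul_le_mul_of_nonneg_left (h2.trans_eq h3) (Real.exp_pos _).le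
    _ = _ := by ring

/-- Cut at `t = (n + 1)^(1/b)`, where `(n + 1) w = 1`. Beyond `t` the tail mass suffices. Below `t`,
use `one_sub_w_pow_le` with `b k > a - 1`, so that the integral is governed by its upper endpoint.
-/
theorem exists_holdMoment_le (ha : 1 < a) (hb : 0 < b) :
    ∃ C : ℝ, 0 ≤ C ∧ ∀ n : ℕ, holdMoment a b n ≤ C * ((n : ℝ) + 1) ^ (-((a - 1) / b)) := by
  have := isProbabilityMeasure_nu ha
  obtain ⟨k, hk⟩ := exists_nat_gt ((a - 1) / b)
  have hk' : 0 < b * k - (a - 1) := by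
    rw [div_lt_iff₀ hb] at hk
    linarith
  have ha' : 0 < a - 1 := by linarith
  set D : ℝ := Real.exp 1 * k.factorial * ((a - 1) / (b * k - (a - 1))) with hD
  refine ⟨D + 1, by positivity, fun n => ?_⟩
  set N : ℝ := (n : ℝ) + 1 with hN
  have hN1 : 1 ≤ N := by simp [hN]
  have hN0 : 0 < N := by linarith
  set t : ℝ := N ^ (1 / b) with ht
  have ht1 : 1 ≤ t := Real.one_le_rpow hN1 (by positivity)
  have ht0 : 0 < t := by linarith
  have hta : t ^ (-(a - 1)) = N ^ (-((a - 1) / b)) := by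
    rw [ht, ← Real.rpow_mul hN0.le]
    congr 1
    ring
  have htb : t ^ (b * k - (a - 1)) = N ^ (k : ℝ) * N ^ (-((a - 1) / b)) := by
    rw [ht, ← Real.rpow_mul hN0.le, ← Real.rpow_add hN0]
    congr 1
    field_simp
    ring
  have hsplit : holdMoment a b n =
      ∫ x in (tail t)ᶜ, (1 - w b x) ^ n ∂nu a + ∫ x in tail t, (1 - w b x) ^ n ∂nu a := by
    rw [add_comm]
    exact (integral_add_compl (measurableSet_tail t) (integrable_one_sub_w_pow hb n)).symm
  have htail : ∫ x in tail t, (1 - w b x) ^ n ∂nu a ≤ N ^ (-((a - 1) / b)) := by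
    calc ∫ x in tail t, (1 - w b x) ^ n ∂nu a ≤ ∫ _ in tail t, (1 : ℝ) ∂nu a :=
          integral_mono (integrable_one_sub_w_pow hb n) (integrable_const _)
            fun x => one_sub_w_pow_le_one hb n x
      _ = N ^ (-((a - 1) / b)) := by
          rw [setIntegral_const, measureReal_def, nu_tail ha ht1,
            ENNReal.toReal_ofReal (by positivity), hta, smul_eq_mul, mul_one]
  have hhead : ∫ x in (tail t)ᶜ, (1 - w b x) ^ n ∂nu a ≤ D * N ^ (-((a - 1) / b)) := by
    set c : ℝ := Real.exp 1 * k.factorial * N ^ (-(k : ℝ)) with hc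
    have hc0 : 0 ≤ c := by positivity
    have hmeas := (measurableSet_tail t).compl
    have hint : IntegrableOn (fun x : E => c * (x : ℝ) ^ (b * k)) (tail t)ᶜ (nu a) := by
      refine Integrable.of_bound (Measurable.aestronglyMeasurable (by fun_prop)) (c * t ^ (b * k)) ?_
      filter_upwards [ae_restrict_mem hmeas] with x hx
      have hx0 := coe_pos x
      have hxt : (x : ℝ) ≤ t := le_of_not_ge fun h => hx h
      rw [Real.norm_of_nonneg (by positivity)]
      gcongr
    have hreal (x : E) : (a - 1) / (x : ℝ) ^ a *
        ((tail t)ᶜ.indicator (fun x : E => c * (x : ℝ) ^ (b * k)) x) =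
        (Set.Iio t).indicator (fun y : ℝ => c * (a - 1) * y ^ (b * k - a)) x := by
      have hx0 := coe_pos x
      by_cases hx : (x : ℝ) < t
      · rw [Set.indicator_of_mem (show x ∈ (tail t)ᶜ from not_le.2 hx),
          Set.indicator_of_mem (show (x : ℝ) ∈ Set.Iio t from hx), Real.rpow_sub hx0]
        ring
      · rw [Set.indicator_of_notMem (show x ∉ (tail t)ᶜ from fun h => hx (not_le.1 h)),
          Set.indicator_of_notMem (show (x : ℝ) ∉ Set.Iio t from hx), mul_zero]
    have hpow : ∫ y in (1 : ℝ)..t, y ^ (b * k - a) ≤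
        t ^ (b * k - (a - 1)) / (b * k - (a - 1)) := by
      rw [integral_rpow (Or.inr ⟨by linarith, by
        rw [Set.uIcc_of_le ht1]; exact fun h => by linarith [h.1]⟩),
        show b * k - a + 1 = b * k - (a - 1) by ring]
      gcongr
      simp
    calc ∫ x in (tail t)ᶜ, (1 - w b x) ^ n ∂nu a
        ≤ ∫ x in (tail t)ᶜ, c * (x : ℝ) ^ (b * k) ∂nu a :=
          setIntegral_mono (integrable_one_sub_w_pow hb n).integrableOn hint
            fun x => one_sub_w_pow_le hb n k x
      _ = ∫ y in Set.Ioi (1 : ℝ),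
            (Set.Iio t).indicator (fun y : ℝ => c * (a - 1) * y ^ (b * k - a)) y := by
          rw [← integral_indicator hmeas, integral_nu ha, ← integral_lebesgue]
          exact integral_congr_ae (ae_of_all _ hreal)
      _ = c * (a - 1) * ∫ y in (1 : ℝ)..t, y ^ (b * k - a) := by
          rw [setIntegral_indicator measurableSet_Iio, Set.Ioi_inter_Iio,
            ← integral_Ioc_eq_integral_Ioo, ← intervalIntegral.integral_of_le ht1,
            intervalIntegral.integral_const_mul]
      _ ≤ c * (a - 1) * (t ^ (b * k - (a - 1)) / (b * k - (a - 1))) := by gcongr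
      _ = D * N ^ (-((a - 1) / b)) := by
          rw [htb, hc, hD, Real.rpow_neg hN0.le (k : ℝ)]
          have : N ^ (k : ℝ) ≠ 0 := by positivity
          field_simp
  rw [hsplit]
  linarith

theorem holdMoment_pos (ha : 1 < a) (hb : 0 < b) (n : ℕ) : 0 < holdMoment a b n := by
  have := isProbabilityMeasure_nu ha
  have hq : 0 < 1 - (2 : ℝ) ^ (-b) :=
    sub_pos.2 (Real.rpow_lt_one_of_one_lt_of_neg one_lt_two (by linarith))
  have hle : ∫ x, (tail 2).indicator (fun _ => (1 - (2 : ℝ) ^ (-b)) ^ n) x ∂nu a ≤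
      holdMoment a b n := by
    refine integral_mono ((integrable_const _).indicator (measurableSet_tail 2))
      (integrable_one_sub_w_pow hb n) fun x => ?_
    by_cases hx : x ∈ tail 2
    · rw [Set.indicator_of_mem hx]
      refine pow_le_pow_left₀ hq.le (sub_le_sub_left ?_ 1) n
      exact Real.rpow_le_rpow_of_nonpos two_pos hx (by linarith)
    · rw [Set.indicator_of_notMem hx]
      exact one_sub_w_pow_nonneg hb n x
  refine lt_of_lt_of_le ?_ hle
  rw [integral_indicator_const _ (measurableSet_tail 2), measureReal_def,
    nu_tail ha one_le_two, ENNReal.toReal_ofReal (by positivity), smul_eq_mul]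
  positivity

/-- Cauchy–Schwarz, via the nonnegative quadratic `t ↦ ν((1-w)^n (t - (1-w))²)` at its minimiser. -/
theorem holdMoment_logConvex (ha : 1 < a) (hb : 0 < b) (n : ℕ) :
    holdMoment a b (n + 1) ^ 2 ≤ holdMoment a b n * holdMoment a b (n + 2) := by
  have := isProbabilityMeasure_nu ha
  have hpos := holdMoment_pos ha hb n
  set t := holdMoment a b (n + 1) / holdMoment a b n with ht
  have h1 : 0 ≤ ∫ x, (1 - w b x) ^ n * (t - (1 - w b x)) ^ 2 ∂nu a :=
    integral_nonneg fun x => mul_nonneg (one_sub_w_pow_nonneg hb n x) (sq_nonneg _)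
  have h2 : ∫ x, (1 - w b x) ^ n * (t - (1 - w b x)) ^ 2 ∂nu a =
      t ^ 2 * holdMoment a b n - 2 * t * holdMoment a b (n + 1) + holdMoment a b (n + 2) := by
    have e (x : E) : (1 - w b x) ^ n * (t - (1 - w b x)) ^ 2 = t ^ 2 * (1 - w b x) ^ n -
        2 * t * (1 - w b x) ^ (n + 1) + (1 - w b x) ^ (n + 2) := by ring
    simp_rw [e, holdMoment]
    rw [integral_add _ (integrable_one_sub_w_pow hb _), integral_sub, integral_const_mul,
      integral_const_mul]
    · exact (integrable_one_sub_w_pow hb _).const_mul _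
    · exact (integrable_one_sub_w_pow hb _).const_mul _
    · exact ((integrable_one_sub_w_pow hb _).const_mul _).sub
        ((integrable_one_sub_w_pow hb _).const_mul _)
  have h3 : t * holdMoment a b n = holdMoment a b (n + 1) := div_mul_cancel₀ _ hpos.ne'
  rw [h2] at h1
  have h4 := mul_nonneg hpos.le h1
  rw [← h3] at h4 ⊢
  nlinarith

theorem coe_rpow_sub (x : E) : (x : ℝ) ^ (a - b) = (x : ℝ) ^ a * w b x := by
  rw [w, Real.rpow_neg (coe_pos x).le, Real.rpow_sub (coe_pos x), div_eq_mul_inv]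

theorem withDensity_inv_w (ha : 1 < a) (hab : b < a - 1) :
    (nu a).withDensity (fun x => ENNReal.ofReal (w b x)⁻¹) =
      ENNReal.ofReal ((a - 1) / (a - b - 1)) • nu (a - b) := by
  have hw : Measurable fun x => ENNReal.ofReal (w b x)⁻¹ := (measurable_w b).inv.ennreal_ofReal
  rw [nu, nu, ← withDensity_mul _ (measurable_density a) hw,
    ← withDensity_smul _ (measurable_density (a - b))]
  congr 1
  ext x
  have hx := coe_pos x
  have hwx := w_pos b x
  have h1 : 0 < a - b - 1 := by linarith
  simp only [Pi.mul_apply, Pi.smul_apply, smul_eq_mul]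
  rw [← ENNReal.ofReal_mul (density_nonneg ha x),
    ← ENNReal.ofReal_mul (div_nonneg (by linarith) h1.le), coe_rpow_sub]
  congr 1
  field_simp

theorem lintegral_inv_w (ha : 1 < a) (hab : b < a - 1) :
    ∫⁻ x, ENNReal.ofReal (w b x)⁻¹ ∂nu a = ENNReal.ofReal ((a - 1) / (a - b - 1)) := by
  have := isProbabilityMeasure_nu (show 1 < a - b by linarith)
  rw [← setLIntegral_univ, ← withDensity_apply _ MeasurableSet.univ, withDensity_inv_w ha hab]
  simp

theorem mu_eq_nu (ha : 1 < a) (hab : b < a - 1) : mu a b = nu (a - b) := by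
  rw [mu, lintegral_inv_w ha hab, withDensity_inv_w ha hab, smul_smul, ENNReal.inv_mul_cancel,
    one_smul]
  · exact (ENNReal.ofReal_pos.2 (div_pos (by linarith) (by linarith))).ne'
  · exact ENNReal.ofReal_ne_top

/-- The identity `w μ = ν / m` turns `μ`-averages of refreshment weights into `ν`-moments, gaining a
full power of decay. -/
theorem integral_nu_sub_w_mul (ha : 1 < a) (hab : b < a - 1) (f : E → ℝ) :
    ∫ x, w b x * f x ∂nu (a - b) = ((a - 1) / (a - b - 1))⁻¹ * ∫ x, f x ∂nu a := by
  rw [integral_nu ha, integral_nu (show 1 < a - b by linarith), ← integral_const_mul]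
  congr 1
  ext x
  have hx := coe_pos x
  have hwx := w_pos b x
  have h1 : 0 < a - b - 1 := by linarith
  have h2 : 0 < a - 1 := by linarith
  rw [coe_rpow_sub]
  field_simp

/-- The geometric sum behind the stationary law: `μ` averages the truncated tours. -/
theorem sum_integral_one_sub_w_pow (ha : 1 < a) (hb : 0 < b) (hab : b < a - 1) {f : E → ℝ}
    (hf : Measurable f) {C : ℝ} (hC : ∀ x, |f x| ≤ C) (n : ℕ) :
    ((a - 1) / (a - b - 1))⁻¹ * ∑ l ∈ Finset.range n, ∫ x, (1 - w b x) ^ l * f x ∂nu a =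
      ∫ x, f x ∂nu (a - b) - ∫ x, (1 - w b x) ^ n * f x ∂nu (a - b) := by
  have := isProbabilityMeasure_nu ha
  have := isProbabilityMeasure_nu (show 1 < a - b by linarith)
  rw [← integral_finsetSum _ fun l _ => integrable_one_sub_w_pow_mul hb l hf hC,
    ← integral_nu_sub_w_mul ha hab,
    ← integral_sub (integrable_of_bounded hf C hC) (integrable_one_sub_w_pow_mul hb n hf hC)]
  congr 1
  ext x
  have := mul_neg_geom_sum (1 - w b x) n
  rw [← Finset.sum_mul]
  linear_combination f x * this

theorem sum_holdMoment (ha : 1 < a) (hb : 0 < b) (hab : b < a - 1) (n : ℕ) :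
    ((a - 1) / (a - b - 1))⁻¹ * ∑ l ∈ Finset.range n, holdMoment a b l =
      1 - holdMoment (a - b) b n := by
  have := isProbabilityMeasure_nu (show 1 < a - b by linarith)
  simpa [holdMoment] using
    sum_integral_one_sub_w_pow ha hb hab (f := fun _ => 1) measurable_const (C := 1) (by simp) n

theorem tendsto_holdMoment (ha : 1 < a) (hb : 0 < b) :
    Tendsto (holdMoment a b) atTop (𝓝 0) := by
  obtain ⟨C, -, hC⟩ := exists_holdMoment_le ha hb
  have hlim : Tendsto (fun n : ℕ => C * ((n : ℝ) + 1) ^ (-((a - 1) / b))) atTop (𝓝 (C * 0)) := by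
    refine Tendsto.const_mul _ ((tendsto_rpow_neg_atTop (div_pos (by linarith) hb)).comp ?_)
    exact tendsto_atTop_add_const_right _ _ tendsto_natCast_atTop_atTop
  rw [mul_zero] at hlim
  exact squeeze_zero (holdMoment_nonneg a hb) hC hlim

theorem hasSum_holdMoment (ha : 1 < a) (hb : 0 < b) (hab : b < a - 1) :
    HasSum (holdMoment a b) ((a - 1) / (a - b - 1)) := by
  have hm : (a - 1) / (a - b - 1) ≠ 0 := (div_pos (by linarith) (by linarith)).ne'
  rw [hasSum_iff_tendsto_nat_of_nonneg (holdMoment_nonneg a hb)]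
  have h1 (n : ℕ) : ∑ l ∈ Finset.range n, holdMoment a b l =
      (a - 1) / (a - b - 1) * (1 - holdMoment (a - b) b n) := by
    rw [← sum_holdMoment ha hb hab, mul_inv_cancel_left₀ hm]
  simp_rw [h1]
  simpa using ((tendsto_holdMoment (show 1 < a - b by linarith) hb).const_sub 1).const_mul
    ((a - 1) / (a - b - 1))

end Pareto
-- Reversibility, regeneration and the total variation rate.
section Chain

variable {a b : ℝ}

theorem P_apply (a b : ℝ) (x : E) : P a b x =
    ENNReal.ofReal (w b x) • nu a + ENNReal.ofReal (1 - w b x) • Measure.dirac x := rfl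

theorem isMarkovKernel_P (ha : 1 < a) (hb : 0 < b) : IsMarkovKernel (P a b) := by
  have := isProbabilityMeasure_nu ha
  refine ⟨fun x => ⟨?_⟩⟩
  rw [P_apply, Measure.add_apply, Measure.smul_apply, Measure.smul_apply, measure_univ,
    measure_univ, smul_eq_mul, smul_eq_mul, mul_one, mul_one,
    ← ENNReal.ofReal_add (w_pos b x).le (sub_nonneg.2 (w_le_one hb x))]
  simp

theorem setLIntegral_w_mu (a b : ℝ) {A : Set E} (hA : MeasurableSet A) :
    ∫⁻ x in A, ENNReal.ofReal (w b x) ∂mu a b =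
      (∫⁻ x, ENNReal.ofReal (w b x)⁻¹ ∂nu a)⁻¹ * nu a A := by
  have hw : Measurable fun x => ENNReal.ofReal (w b x)⁻¹ := (measurable_w b).inv.ennreal_ofReal
  rw [mu, Measure.restrict_smul, lintegral_smul_measure, smul_eq_mul, restrict_withDensity hA,
    lintegral_withDensity_eq_lintegral_mul _ hw (measurable_w b).ennreal_ofReal]
  congr 1
  rw [← setLIntegral_one]
  congr 1
  ext x
  rw [Pi.mul_apply, ← ENNReal.ofReal_mul (inv_nonneg.2 (w_pos b x).le),
    inv_mul_cancel₀ (w_pos b x).ne', ENNReal.ofReal_one]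

/-- The refreshment flow from `A` to `B` is a multiple of `ν(A) ν(B)`, because `w μ` is a multiple
of `ν`; the holding flow depends only on `A ∩ B`. -/
theorem isReversible_P (a b : ℝ) : (P a b).IsReversible (mu a b) := by
  have key {A B : Set E} (hA : MeasurableSet A) (hB : MeasurableSet B) :
      ∫⁻ x in A, P a b x B ∂mu a b =
        (∫⁻ x, ENNReal.ofReal (w b x)⁻¹ ∂nu a)⁻¹ * nu a A * nu a B +
          ∫⁻ x in B ∩ A, ENNReal.ofReal (1 - w b x) ∂mu a b := by
    have hw := measurable_w b
    have h1 (x : E) : P a b x B = ENNReal.ofReal (w b x) * nu a B +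
        B.indicator (fun x => ENNReal.ofReal (1 - w b x)) x := by
      rw [P_apply, Measure.add_apply, Measure.smul_apply, Measure.smul_apply, smul_eq_mul,
        smul_eq_mul, Measure.dirac_apply' x hB]
      by_cases hx : x ∈ B <;> simp [hx]
    simp_rw [h1]
    rw [lintegral_add_left (by fun_prop), lintegral_mul_const _ (by fun_prop),
      setLIntegral_w_mu a b hA, lintegral_indicator hB, Measure.restrict_restrict hB]
  intro A B hA hB
  rw [key hA hB, key hB hA, Set.inter_comm, mul_right_comm]

theorem invariant_pow {X : Type*} [MeasurableSpace X] {κ : Kernel X X} {μ : Measure X}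
    (h : κ.Invariant μ) (n : ℕ) : (κ ^ n).Invariant μ := by
  induction n with
  | zero => exact Measure.id_comp
  | succ n ih => rw [pow_succ]; exact ih.comp h

theorem isMarkovKernel_pow {X : Type*} [MeasurableSpace X] {κ : Kernel X X} [IsMarkovKernel κ]
    (n : ℕ) : IsMarkovKernel (κ ^ n) := by
  induction n with
  | zero => exact inferInstanceAs (IsMarkovKernel Kernel.id)
  | succ n ih => rw [pow_succ]; exact inferInstanceAs (IsMarkovKernel ((κ ^ n) ∘ₖ κ))

/-- The function `P ^ n f`. -/
noncomputable def iter (a b : ℝ) (f : E → ℝ) (n : ℕ) (x : E) : ℝ :=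
  ∫ y, f y ∂((P a b ^ n) x)

theorem measurable_iter {f : E → ℝ} (hf : Measurable f) (n : ℕ) : Measurable (iter a b f n) :=
  (hf.stronglyMeasurable.integral_kernel (κ := P a b ^ n)).measurable

theorem abs_iter_le (ha : 1 < a) (hb : 0 < b) {f : E → ℝ} {C : ℝ} (hC : ∀ x, |f x| ≤ C) (n : ℕ)
    (x : E) : |iter a b f n x| ≤ C := by
  have := isMarkovKernel_P ha hb
  have := isMarkovKernel_pow (κ := P a b) n
  simpa [iter] using norm_integral_le_of_norm_le_const (μ := (P a b ^ n) x) (f := f) (ae_of_all _ hC)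

theorem iter_zero {f : E → ℝ} (hf : Measurable f) (x : E) : iter a b f 0 x = f x := by
  change ∫ y, f y ∂(Kernel.id x) = f x
  rw [Kernel.id_apply, integral_dirac' _ _ hf.stronglyMeasurable]

theorem iter_succ (ha : 1 < a) (hb : 0 < b) {f : E → ℝ} (hf : Measurable f) {C : ℝ}
    (hC : ∀ x, |f x| ≤ C) (n : ℕ) (x : E) :
    iter a b f (n + 1) x = w b x * ∫ y, iter a b f n y ∂nu a + (1 - w b x) * iter a b f n x := by
  have := isProbabilityMeasure_nu ha
  have := isMarkovKernel_P ha hb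
  have := isMarkovKernel_pow (κ := P a b) n
  have h1 : P a b ^ (n + 1) = (P a b ^ n) ∘ₖ P a b := pow_succ _ _
  have hm := measurable_iter (a := a) (b := b) hf n
  have hi {ρ : Measure E} [IsFiniteMeasure ρ] : Integrable (iter a b f n) ρ :=
    integrable_of_bounded hm C (abs_iter_le ha hb hC n)
  rw [iter, h1, Kernel.integral_comp (integrable_of_bounded hf C hC)]
  change ∫ y, iter a b f n y ∂(P a b x) = _
  rw [P_apply, integral_add_measure (hi.smul_measure ENNReal.ofReal_ne_top)
    (hi.smul_measure ENNReal.ofReal_ne_top), integral_smul_measure, integral_smul_measure,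
    integral_dirac' _ _ hm.stronglyMeasurable, ENNReal.toReal_ofReal (w_pos b x).le,
    ENNReal.toReal_ofReal (sub_nonneg.2 (w_le_one hb x)), smul_eq_mul, smul_eq_mul]

/-- Decomposition of `P ^ n f` at the first refreshment. -/
theorem iter_eq (ha : 1 < a) (hb : 0 < b) {f : E → ℝ} (hf : Measurable f) {C : ℝ}
    (hC : ∀ x, |f x| ≤ C) (n : ℕ) (x : E) :
    iter a b f n x = (1 - w b x) ^ n * f x +
      ∑ j ∈ Finset.range n, w b x * (1 - w b x) ^ j * ∫ y, iter a b f (n - 1 - j) y ∂nu a := by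
  induction n with
  | zero => simp [iter_zero hf]
  | succ n ih =>
    rw [iter_succ ha hb hf hC, ih, Finset.sum_range_succ', mul_add, Finset.mul_sum]
    have h1 (j : ℕ) : n + 1 - 1 - (j + 1) = n - 1 - j := by omega
    simp_rw [h1]
    rw [Nat.add_sub_cancel, Nat.sub_zero, pow_zero, mul_one, pow_succ]
    have h2 : ∑ j ∈ Finset.range n, (1 - w b x) *
        (w b x * (1 - w b x) ^ j * ∫ y, iter a b f (n - 1 - j) y ∂nu a) =
        ∑ j ∈ Finset.range n, w b x * (1 - w b x) ^ (j + 1) *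
          ∫ y, iter a b f (n - 1 - j) y ∂nu a :=
      Finset.sum_congr rfl fun j _ => by ring
    rw [h2]
    ring

theorem integral_w_mul_pow (ha : 1 < a) (hb : 0 < b) (j : ℕ) :
    ∫ x, w b x * (1 - w b x) ^ j ∂nu a = holdMoment a b j - holdMoment a b (j + 1) := by
  have := isProbabilityMeasure_nu ha
  rw [holdMoment, holdMoment, ← integral_sub (integrable_one_sub_w_pow hb _)
    (integrable_one_sub_w_pow hb _)]
  congr 1
  ext x
  ring

theorem integrable_w_mul_pow (hb : 0 < b) {ρ : Measure E} [IsFiniteMeasure ρ] (j : ℕ) :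
    Integrable (fun x => w b x * (1 - w b x) ^ j) ρ := by
  simp_rw [mul_comm (w b _)]
  exact integrable_one_sub_w_pow_mul hb j (measurable_w b) (C := 1) fun x => by
    rw [abs_of_pos (w_pos b x)]
    exact w_le_one hb x

/-- This is the renewal equation required by `abs_renewal_sub_le`, with forcing term `φ n =
ν((1-w)^n f)`. -/
theorem integral_iter_eq (ha : 1 < a) (hb : 0 < b) {f : E → ℝ} (hf : Measurable f) {C : ℝ}
    (hC : ∀ x, |f x| ≤ C) (n : ℕ) :
    ∫ x, iter a b f n x ∂nu a = ∫ x, (1 - w b x) ^ n * f x ∂nu a +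
      ∑ j ∈ Finset.range n, (holdMoment a b j - holdMoment a b (j + 1)) *
        ∫ x, iter a b f (n - 1 - j) x ∂nu a := by
  have := isProbabilityMeasure_nu ha
  simp_rw [iter_eq ha hb hf hC n]
  rw [integral_add (integrable_one_sub_w_pow_mul hb n hf hC)
    (integrable_finsetSum _ fun j _ => (integrable_w_mul_pow hb j).mul_const _),
    integral_finsetSum _ fun j _ => (integrable_w_mul_pow hb j).mul_const _]
  congr 1
  exact Finset.sum_congr rfl fun j _ => by rw [integral_mul_const, integral_w_mul_pow ha hb]

theorem abs_integral_iter_sub_le (ha : 1 < a) (hb : 0 < b) (hab : b < a - 1) {f : E → ℝ}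
    (hf : Measurable f) (hf1 : ∀ x, |f x| ≤ 1) (n : ℕ) :
    |∫ x, iter a b f n x ∂nu a - ∫ x, f x ∂nu (a - b)| ≤ 2 * holdMoment (a - b) b (n + 1) := by
  have := isProbabilityMeasure_nu ha
  have := isProbabilityMeasure_nu (show 1 < a - b by linarith)
  have habs {ρ : Measure E} [IsFiniteMeasure ρ] (n : ℕ) :
      |∫ x, (1 - w b x) ^ n * f x ∂ρ| ≤ ∫ x, (1 - w b x) ^ n ∂ρ := by
    refine abs_integral_le_integral_abs.trans (integral_mono
      (integrable_one_sub_w_pow_mul hb n hf hf1).abs (integrable_one_sub_w_pow hb n) fun x => ?_)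
    simp only
    rw [abs_mul, abs_of_nonneg (one_sub_w_pow_nonneg hb n x)]
    exact mul_le_of_le_one_right (one_sub_w_pow_nonneg hb n x) (hf1 x)
  have := abs_renewal_sub_le (L := ∫ x, f x ∂nu (a - b)) (holdMoment_pos ha hb)
    (holdMoment_zero ha b) (holdMoment_logConvex ha hb) (hasSum_holdMoment ha hb hab)
    (φ := fun n => ∫ x, (1 - w b x) ^ n * f x ∂nu a)
    (g := fun n => ∫ x, iter a b f n x ∂nu a) habs (integral_iter_eq ha hb hf hf1) n
  rw [sum_holdMoment ha hb hab, sum_integral_one_sub_w_pow ha hb hab hf hf1] at this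
  rw [show (2 : ℝ) * holdMoment (a - b) b (n + 1) = 2 * (1 - (1 - holdMoment (a - b) b (n + 1)))
    by ring]
  refine this ?_
  rw [sub_sub_cancel_left, abs_neg, sub_sub_cancel]
  exact habs (n + 1)

/-- Explicit bound on the distance of `P ^ n f (x)` to its limit, uniform over `|f| ≤ 1`. -/
noncomputable def deviation (a b : ℝ) (n : ℕ) (x : E) : ℝ :=
  2 * (1 - w b x) ^ n + ∑ j ∈ Finset.range n,
    w b x * (1 - w b x) ^ j * (2 * holdMoment (a - b) b (n - 1 - j + 1))

theorem deviation_nonneg (a : ℝ) (hb : 0 < b) (n : ℕ) (x : E) : 0 ≤ deviation a b n x :=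
  add_nonneg (mul_nonneg zero_le_two (one_sub_w_pow_nonneg hb n x)) <|
    Finset.sum_nonneg fun j _ => mul_nonneg
      (mul_nonneg (w_pos b x).le (one_sub_w_pow_nonneg hb j x))
      (mul_nonneg zero_le_two (holdMoment_nonneg _ hb _))

theorem abs_iter_sub_le (ha : 1 < a) (hb : 0 < b) (hab : b < a - 1) {f : E → ℝ}
    (hf : Measurable f) (hf1 : ∀ x, |f x| ≤ 1) (n : ℕ) (x : E) :
    |iter a b f n x - ∫ x, f x ∂nu (a - b)| ≤ deviation a b n x := by
  have := isProbabilityMeasure_nu (show 1 < a - b by linarith)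
  set L := ∫ x, f x ∂nu (a - b) with hL
  have hL1 : |L| ≤ 1 := by
    simpa using norm_integral_le_of_norm_le_const (μ := nu (a - b)) (f := f) (ae_of_all _ hf1)
  -- The weights `(1-w)^n` and `w (1-w)^j`, `j < n`, sum to one, so `L` can be subtracted inside
  -- each term.
  have hdecomp : iter a b f n x - L = (1 - w b x) ^ n * (f x - L) + ∑ j ∈ Finset.range n,
      w b x * (1 - w b x) ^ j * (∫ y, iter a b f (n - 1 - j) y ∂nu a - L) := by
    have hgeom := mul_neg_geom_sum (1 - w b x) n
    rw [iter_eq ha hb hf hf1]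
    simp_rw [mul_sub _ _ L]
    rw [Finset.sum_sub_distrib, ← Finset.sum_mul, ← Finset.mul_sum]
    linear_combination L * hgeom
  rw [hdecomp, deviation]
  refine (abs_add_le _ _).trans (add_le_add ?_ ?_)
  · rw [abs_mul, abs_of_nonneg (one_sub_w_pow_nonneg hb n x), mul_comm]
    exact mul_le_mul_of_nonneg_right ((abs_sub _ _).trans (by linarith [hf1 x]))
      (one_sub_w_pow_nonneg hb n x)
  · refine (Finset.abs_sum_le_sum_abs _ _).trans (Finset.sum_le_sum fun j _ => ?_)
    have h0 := mul_nonneg (w_pos b x).le (one_sub_w_pow_nonneg hb j x)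
    rw [abs_mul, abs_of_nonneg h0]
    exact mul_le_mul_of_nonneg_left (abs_integral_iter_sub_le ha hb hab hf hf1 _) h0

theorem rate_eq (hb : 0 < b) : -((a - 1) / b) = -((a - b - 1) / b) - 1 := by
  field_simp
  ring

theorem exists_convolution_holdMoment_le (hb : 0 < b) (hab : b < a - 1)
    {α : ℕ → ℝ} {A : ℝ} (hA : 0 ≤ A)
    (hα : ∀ j : ℕ, α j ≤ A * ((j : ℝ) + 1) ^ (-((a - 1) / b))) :
    ∃ K : ℝ, 0 ≤ K ∧ ∀ n : ℕ, 1 ≤ n → ∑ j ∈ Finset.range n,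
      α j * (2 * holdMoment (a - b) b (n - 1 - j + 1)) ≤ K * (n : ℝ) ^ (-((a - b - 1) / b)) := by
  have hκ : 0 < (a - b - 1) / b := div_pos (by linarith) hb
  obtain ⟨K, hK0, hK⟩ := exists_convolution_bound hκ
  obtain ⟨C, hC0, hC⟩ := exists_holdMoment_le (show 1 < a - b by linarith) hb
  rw [rate_eq hb] at hα
  refine ⟨A * (2 * C) * K, by positivity, fun n hn => ?_⟩
  refine convolution_le (r := fun k => 2 * holdMoment (a - b) b (k + 1)) hA (hK n hn)
    (by positivity) hα (fun j => mul_nonneg zero_le_two (holdMoment_nonneg _ hb _)) fun j => ?_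
  rw [mul_assoc]
  refine mul_le_mul_of_nonneg_left ((hC (j + 1)).trans (mul_le_mul_of_nonneg_left ?_ hC0))
    zero_le_two
  exact Real.rpow_le_rpow_of_nonpos (by positivity) (by push_cast; linarith) (by linarith)

theorem exists_deviation_le (hb : 0 < b) (hab : b < a - 1) (x : E) :
    ∃ K : ℝ, 0 ≤ K ∧ ∀ n : ℕ, 1 ≤ n → deviation a b n x ≤ K * (n : ℝ) ^ (-((a - b - 1) / b)) := by
  have hκ : 0 < (a - b - 1) / b := div_pos (by linarith) hb
  obtain ⟨A, hA0, hA⟩ := exists_pow_le_rpow (sub_nonneg.2 (w_le_one hb x))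
    (by linarith [w_pos b x]) ((a - 1) / b)
  obtain ⟨K, hK0, hK⟩ := exists_convolution_holdMoment_le hb hab
    (α := fun j => w b x * (1 - w b x) ^ j) hA0 fun j =>
      (mul_le_of_le_one_left (one_sub_w_pow_nonneg hb j x) (w_le_one hb x)).trans (hA j)
  refine ⟨2 * A + K, by positivity, fun n hn => ?_⟩
  have hn0 : (1 : ℝ) ≤ n := by exact_mod_cast hn
  have h1 : ((n : ℝ) + 1) ^ (-((a - 1) / b)) ≤ (n : ℝ) ^ (-((a - b - 1) / b)) := by
    rw [rate_eq hb]
    exact (Real.rpow_le_rpow_of_nonpos (by linarith) (by linarith) (by linarith)).trans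
      (Real.rpow_le_rpow_of_exponent_le hn0 (by linarith))
  rw [deviation, add_mul, mul_assoc]
  exact add_le_add (mul_le_mul_of_nonneg_left
    ((hA n).trans (mul_le_mul_of_nonneg_left h1 hA0)) zero_le_two) (hK n hn)

theorem integrable_deviation (a : ℝ) (hb : 0 < b) {ρ : Measure E} [IsFiniteMeasure ρ] (n : ℕ) :
    Integrable (deviation a b n) ρ :=
  ((integrable_one_sub_w_pow hb n).const_mul 2).add
    (integrable_finsetSum _ fun j _ => (integrable_w_mul_pow hb j).mul_const _)

/-- Under `μ` the waiting-time weights become `G j / m`, one power better than the tails they are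
convolved with, so the rate of the tails survives. -/
theorem exists_integral_deviation_le (ha : 1 < a) (hb : 0 < b) (hab : b < a - 1) :
    ∃ K : ℝ, 0 ≤ K ∧ ∀ n : ℕ, 1 ≤ n →
      ∫ x, deviation a b n x ∂nu (a - b) ≤ K * (n : ℝ) ^ (-((a - b - 1) / b)) := by
  have := isProbabilityMeasure_nu (show 1 < a - b by linarith)
  have hm : 0 < (a - 1) / (a - b - 1) := div_pos (by linarith) (by linarith)
  have hκ : 0 < (a - b - 1) / b := div_pos (by linarith) hb
  obtain ⟨A, hA0, hA⟩ := exists_holdMoment_le ha hb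
  obtain ⟨C, hC0, hC⟩ := exists_holdMoment_le (show 1 < a - b by linarith) hb
  obtain ⟨K, hK0, hK⟩ := exists_convolution_holdMoment_le hb hab
    (α := fun j => ((a - 1) / (a - b - 1))⁻¹ * holdMoment a b j)
    (A := ((a - 1) / (a - b - 1))⁻¹ * A) (by positivity) fun j => by
      rw [mul_assoc]
      exact mul_le_mul_of_nonneg_left (hA j) (by positivity)
  refine ⟨2 * C + K, by positivity, fun n hn => ?_⟩
  have hn0 : (1 : ℝ) ≤ n := by exact_mod_cast hn
  have h1 : ((n : ℝ) + 1) ^ (-((a - b - 1) / b)) ≤ (n : ℝ) ^ (-((a - b - 1) / b)) :=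
    Real.rpow_le_rpow_of_nonpos (by linarith) (by linarith) (by linarith)
  simp_rw [deviation]
  rw [integral_add ((integrable_one_sub_w_pow hb n).const_mul 2)
    (integrable_finsetSum _ fun j _ => (integrable_w_mul_pow hb j).mul_const _),
    integral_finsetSum _ fun j _ => (integrable_w_mul_pow hb j).mul_const _, integral_const_mul,
    add_mul, mul_assoc]
  simp_rw [integral_mul_const, integral_nu_sub_w_mul ha hab]
  exact add_le_add (mul_le_mul_of_nonneg_left
    ((hC n).trans (mul_le_mul_of_nonneg_left h1 hC0)) zero_le_two) (hK n hn)

theorem tvDist_le (ha : 1 < a) (hb : 0 < b) (hab : b < a - 1) (n : ℕ) (x : E) :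
    tvDist ((P a b ^ n) x) (mu a b) ≤ ENNReal.ofReal (deviation a b n x) := by
  rw [tvDist, mu_eq_nu ha hab]
  refine ENNReal.half_le_self.trans (iSup₂_le fun f hf => ENNReal.ofReal_le_ofReal ?_)
  exact (le_abs_self _).trans (abs_iter_sub_le ha hb hab hf.1 hf.2 n x)

theorem tendsto_rpow_mul_tvDist (ha : 1 < a) (hb : 0 < b) (hab : b < a - 1) {s : ℝ}
    (hs : s < (a - b - 1) / b) (x : E) :
    Tendsto (fun n : ℕ => ENNReal.ofReal ((n : ℝ) ^ s) * tvDist ((P a b ^ n) x) (mu a b)) atTop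
      (𝓝 0) := by
  obtain ⟨K, hK0, hK⟩ := exists_deviation_le hb hab x
  have hlim : Tendsto (fun n : ℕ => ENNReal.ofReal (K * (n : ℝ) ^ (-((a - b - 1) / b - s)))) atTop
      (𝓝 0) := by
    have := ((tendsto_rpow_neg_atTop (sub_pos.2 hs)).comp tendsto_natCast_atTop_atTop).const_mul K
    rw [mul_zero] at this
    simpa using ENNReal.tendsto_ofReal this
  refine tendsto_of_tendsto_of_tendsto_of_le_of_le' tendsto_const_nhds hlim
    (Eventually.of_forall fun n => zero_le) ?_
  filter_upwards [eventually_ge_atTop 1] with n hn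
  have hn0 : (0 : ℝ) < n := by exact_mod_cast hn
  calc _ ≤ ENNReal.ofReal ((n : ℝ) ^ s) *
        ENNReal.ofReal (K * (n : ℝ) ^ (-((a - b - 1) / b))) := by
        gcongr
        exact (tvDist_le ha hb hab n x).trans (ENNReal.ofReal_le_ofReal (hK n hn))
    _ = _ := by
        rw [← ENNReal.ofReal_mul (by positivity), neg_sub, sub_eq_add_neg s, Real.rpow_add hn0]
        congr 1
        ring

end Chain
-- Centred functions of unit essential oscillation.
section Oscillation

theorem ae_abs_le_one_of_mem_unitOsc {X : Type*} [MeasurableSpace X] {μ : Measure X}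
    [IsProbabilityMeasure μ] {f : X → ℝ} (hf : f ∈ unitOsc μ) : ∀ᵐ x ∂μ, |f x| ≤ 1 := by
  obtain ⟨hL, h0, hosc⟩ := hf
  have hup : ∀ᵐ x ∂μ, (f x : EReal) ≤ essSup (fun x => (f x : EReal)) μ := ae_le_essSup
  have hlo : ∀ᵐ x ∂μ, essInf (fun x => (f x : EReal)) μ ≤ f x := ae_essInf_le
  rw [essOsc] at hosc
  have hbot : (⊥ : EReal) ≠ 1 := (EReal.bot_lt_coe 1).ne
  have htop : (⊤ : EReal) ≠ 1 := (EReal.coe_lt_top 1).ne'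
  -- Whenever either bound is infinite the `EReal` difference is `⊤` or `⊥` (also for `⊤ - ⊤ = ⊥`),
  -- never `1`. In the finite case zero mean places `0` between the bounds.
  induction hM : essSup (fun x => (f x : EReal)) μ with
  | bot => simp [hM, hbot] at hosc
  | top =>
    rw [hM] at hosc
    induction hI : essInf (fun x => (f x : EReal)) μ <;> simp [hI, hbot, htop] at hosc
  | coe M =>
    rw [hM] at hosc hup
    induction hI : essInf (fun x => (f x : EReal)) μ with
    | bot => simp [hI, htop] at hosc
    | top => simp [hI, hbot] at hosc
    | coe I =>
      rw [hI] at hosc hlo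
      have h1 : M - I = 1 := by exact_mod_cast hosc
      have hup' : ∀ᵐ x ∂μ, f x ≤ M := hup.mono fun x hx => by exact_mod_cast hx
      have hlo' : ∀ᵐ x ∂μ, I ≤ f x := hlo.mono fun x hx => by exact_mod_cast hx
      have hi : Integrable f μ := hL.integrable one_le_two
      have hM0 : 0 ≤ M := by simpa [h0] using integral_mono_ae hi (integrable_const M) hup'
      have hI0 : I ≤ 0 := by simpa [h0] using integral_mono_ae (integrable_const I) hi hlo'
      filter_upwards [hup', hlo'] with x hx1 hx2
      exact abs_le.2 ⟨by linarith, by linarith⟩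

theorem exists_bounded_version {X : Type*} [MeasurableSpace X] {μ : Measure X} {f : X → ℝ}
    (hf : AEStronglyMeasurable f μ) (h1 : ∀ᵐ x ∂μ, |f x| ≤ 1) :
    ∃ g : X → ℝ, Measurable g ∧ (∀ x, |g x| ≤ 1) ∧ f =ᵐ[μ] g := by
  refine ⟨fun x => max (-1) (min 1 (hf.mk f x)), ?_, fun x => ?_, ?_⟩
  · have := hf.stronglyMeasurable_mk.measurable
    fun_prop
  · exact abs_le.2 ⟨le_max_left _ _, max_le (by norm_num) (min_le_left _ _)⟩
  · filter_upwards [hf.ae_eq_mk, h1] with x hx h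
    rw [← hx, min_eq_right (abs_le.1 h).2, max_eq_right (abs_le.1 h).1]

/-- The centred indicator of an event of probability in `(0, 1)`. -/
theorem indicator_sub_mem_unitOsc {X : Type*} [MeasurableSpace X] {μ : Measure X}
    [IsProbabilityMeasure μ] {A : Set X} (hA : MeasurableSet A) (h0 : 0 < μ.real A)
    (h1 : μ.real A < 1) : (fun x => A.indicator (fun _ => (1 : ℝ)) x - μ.real A) ∈ unitOsc μ := by
  have hmeas : Measurable fun x => A.indicator (fun _ => (1 : ℝ)) x :=
    measurable_const.indicator hA
  have hAc : μ.real Aᶜ = 1 - μ.real A := by rw [measureReal_compl hA, probReal_univ]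
  set p := μ.real A with hp
  have hle (x : X) : A.indicator (fun _ => (1 : ℝ)) x ≤ 1 :=
    Set.indicator_le_self' (fun _ _ => zero_le_one) x
  have hge (x : X) : 0 ≤ A.indicator (fun _ => (1 : ℝ)) x :=
    Set.indicator_nonneg (fun _ _ => zero_le_one) x
  refine ⟨MemLp.of_bound (hmeas.sub_const p).aestronglyMeasurable 1 (ae_of_all _ fun x => ?_),
    ?_, ?_⟩
  · exact abs_le.2 ⟨by linarith [hge x], by linarith [hle x]⟩
  · rw [integral_sub ((integrable_const _).indicator hA) (integrable_const _),
      integral_indicator_const _ hA]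
    simp [hp]
  · have hsup : essSup (fun x => ((A.indicator (fun _ => (1 : ℝ)) x - p : ℝ) : EReal)) μ =
        ((1 - p : ℝ) : EReal) := by
      refine le_antisymm (essSup_le_of_ae_le _ (ae_of_all _ fun x => ?_)) (not_lt.1 fun h => ?_)
      · exact EReal.coe_le_coe_iff.2 (by linarith [hle x])
      · have hae : ∀ᵐ x ∂μ, x ∉ A := by
          filter_upwards [ae_le_essSup (μ := μ)
            (f := fun x => ((A.indicator (fun _ => (1 : ℝ)) x - p : ℝ) : EReal))] with x hx hxA
          rw [Set.indicator_of_mem hxA] at hx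
          exact absurd h hx.not_gt
        have : μ A = 0 := by
          simpa using measure_eq_zero_iff_ae_notMem.2 hae
        rw [hp, measureReal_def, this] at h0
        simp at h0
    have hinf : essInf (fun x => ((A.indicator (fun _ => (1 : ℝ)) x - p : ℝ) : EReal)) μ =
        ((0 - p : ℝ) : EReal) := by
      refine le_antisymm (not_lt.1 fun h => ?_) (le_essInf_of_ae_le _ (ae_of_all _ fun x => ?_))
      · have hae : ∀ᵐ x ∂μ, x ∉ Aᶜ := by
          filter_upwards [ae_essInf_le (μ := μ)
            (f := fun x => ((A.indicator (fun _ => (1 : ℝ)) x - p : ℝ) : EReal))] with x hx hxA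
          rw [Set.indicator_of_notMem hxA] at hx
          exact absurd h hx.not_gt
        have : μ Aᶜ = 0 := by
          simpa using measure_eq_zero_iff_ae_notMem.2 hae
        rw [measureReal_def, this] at hAc
        simp only [ENNReal.toReal_zero] at hAc
        linarith
      · exact EReal.coe_le_coe_iff.2 (by linarith [hge x])
    rw [essOsc, hsup, hinf, ← EReal.coe_sub]
    norm_num

end Oscillation

/-! ### The `L²` rate and its sharpness. -/

section Rates

variable {a b : ℝ}

/-- After `f` is replaced by a version bounded by one, `|Pⁿf|² ≤ |Pⁿf| ≤ deviation` pointwise. -/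
theorem oscToL2_le (ha : 1 < a) (hb : 0 < b) (hab : b < a - 1) (n : ℕ) :
    oscToL2 (mu a b) (P a b ^ n) ≤
      ENNReal.ofReal (∫ x, deviation a b n x ∂nu (a - b)) ^ (1 / 2 : ℝ) := by
  have hprob := isProbabilityMeasure_nu (show 1 < a - b by linarith)
  have := isMarkovKernel_P ha hb
  have hinv := invariant_pow (isReversible_P a b).invariant n
  rw [mu_eq_nu ha hab] at hinv ⊢
  refine iSup₂_le fun f hf => ?_
  obtain ⟨g, hg, hg1, hfg⟩ :=
    exists_bounded_version hf.1.aestronglyMeasurable (ae_abs_le_one_of_mem_unitOsc hf)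
  have hg0 : ∫ x, g x ∂nu (a - b) = 0 := by rw [← integral_congr_ae hfg, hf.2.1]
  have hae : (fun x => ∫ y, f y ∂((P a b ^ n) x)) =ᵐ[nu (a - b)] iter a b g n := by
    -- By invariance a `μ`-null set is null for `Pⁿ(x, ·)` for `μ`-almost every `x`, so changing
    -- version is harmless.
    rw [Filter.EventuallyEq, ← hinv.def] at hfg
    filter_upwards [Measure.ae_ae_of_ae_comp hfg] with x hx
    exact integral_congr_ae hx
  rw [eLpNorm_congr_ae hae, eLpNorm_eq_lintegral_rpow_enorm_toReal two_ne_zero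
    ENNReal.ofNat_ne_top, ENNReal.toReal_ofNat, ofReal_integral_eq_lintegral_ofReal
    (integrable_deviation a hb n) (ae_of_all _ (deviation_nonneg a hb n))]
  refine ENNReal.rpow_le_rpow (lintegral_mono fun x => ?_) (by norm_num)
  have h1 := abs_iter_le ha hb hg1 n x
  have h2 := abs_iter_sub_le ha hb hab hg hg1 n x
  rw [hg0, sub_zero] at h2
  rw [Real.enorm_eq_ofReal_abs, ENNReal.ofReal_rpow_of_nonneg (abs_nonneg _) zero_le_two,
    Real.rpow_two]
  refine ENNReal.ofReal_le_ofReal ?_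
  nlinarith [abs_nonneg (iter a b g n x)]

theorem iSup_rpow_mul_oscToL2_lt_top (ha : 1 < a) (hb : 0 < b) (hab : b < a - 1) {s : ℝ}
    (hs : s ≤ (a - b - 1) / (2 * b)) :
    (⨆ n : ℕ, ⨆ _ : 1 ≤ n, ENNReal.ofReal ((n : ℝ) ^ s) * oscToL2 (mu a b) (P a b ^ n)) < ∞ := by
  obtain ⟨K, hK0, hK⟩ := exists_integral_deviation_le ha hb hab
  refine lt_of_le_of_lt (b := ENNReal.ofReal (K ^ (1 / 2 : ℝ))) (iSup₂_le fun n hn => ?_)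
    ENNReal.ofReal_lt_top
  have hn1 : (1 : ℝ) ≤ n := by exact_mod_cast hn
  have hn0 : (0 : ℝ) < n := by linarith
  calc ENNReal.ofReal ((n : ℝ) ^ s) * oscToL2 (mu a b) (P a b ^ n)
      ≤ ENNReal.ofReal ((n : ℝ) ^ s) *
        ENNReal.ofReal (K * (n : ℝ) ^ (-((a - b - 1) / b))) ^ (1 / 2 : ℝ) := by
        gcongr
        exact (oscToL2_le ha hb hab n).trans (by gcongr; exact hK n hn)
    _ = ENNReal.ofReal (K ^ (1 / 2 : ℝ) * (n : ℝ) ^ (s - (a - b - 1) / (2 * b))) := by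
        rw [ENNReal.ofReal_rpow_of_nonneg (by positivity) (by norm_num),
          ← ENNReal.ofReal_mul (by positivity), Real.mul_rpow hK0 (by positivity),
          ← Real.rpow_mul hn0.le, mul_left_comm, ← Real.rpow_add hn0]
        congr 3
        field_simp
        ring
    _ ≤ ENNReal.ofReal (K ^ (1 / 2 : ℝ)) := by
        refine ENNReal.ofReal_le_ofReal (mul_le_of_le_one_right (by positivity) ?_)
        exact Real.rpow_le_one_of_one_le_of_nonpos hn1 (by linarith)

/-- Keep only the event that no refreshment has occurred by time `n`. -/
theorem pow_le_iter_indicator (ha : 1 < a) (hb : 0 < b) {A : Set E} (hA : MeasurableSet A)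
    (n : ℕ) {x : E} (hx : x ∈ A) :
    (1 - w b x) ^ n ≤ iter a b (A.indicator fun _ => 1) n x := by
  have hbd (y : E) : |A.indicator (fun _ => (1 : ℝ)) y| ≤ 1 := by
    by_cases hy : y ∈ A <;> simp [hy]
  rw [iter_eq ha hb (measurable_const.indicator hA) hbd, Set.indicator_of_mem hx, mul_one]
  refine le_add_of_nonneg_right (Finset.sum_nonneg fun j _ => mul_nonneg
    (mul_nonneg (w_pos b x).le (one_sub_w_pow_nonneg hb j x)) (integral_nonneg fun y => ?_))
  exact integral_nonneg fun z => Set.indicator_nonneg (fun _ _ => zero_le_one) z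

/-- The threshold is where `w = 1/(2n)`; Bernoulli's inequality then applies. -/
theorem half_le_one_sub_w_pow (hb : 0 < b) {n : ℕ} (hn : 1 ≤ n) {x : E}
    (hx : x ∈ tail ((2 * n : ℝ) ^ (1 / b))) : 1 / 2 ≤ (1 - w b x) ^ n := by
  have hn1 : (1 : ℝ) ≤ n := by exact_mod_cast hn
  have hn0 : (0 : ℝ) < n := by linarith
  have hw : w b x ≤ 1 / (2 * n) := by
    calc w b x ≤ ((2 * n : ℝ) ^ (1 / b)) ^ (-b) :=
          Real.rpow_le_rpow_of_nonpos (by positivity) hx (by linarith)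
      _ = 1 / (2 * n) := by
          rw [← Real.rpow_mul (by positivity), show 1 / b * -b = -1 by field_simp,
            Real.rpow_neg_one, one_div]
  have hw1 := w_le_one hb x
  have hbern := one_add_mul_le_pow (show (-2 : ℝ) ≤ -w b x by linarith) n
  have h1 : n * w b x ≤ 1 / 2 := by
    calc n * w b x ≤ n * (1 / (2 * n)) := by gcongr
      _ = 1 / 2 := by field_simp
  rw [sub_eq_add_neg]
  linarith

/-- Test with the centred indicator of that tail. On the tail `Pⁿf ≥ 1/2 - 1/4`, where `hsmall`
bounds the subtracted mean, and the `L²` norm brings in the square root of the tail mass. -/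
theorem le_oscToL2 (ha : 1 < a) (hb : 0 < b) (hab : b < a - 1) {n : ℕ} (hn : 1 ≤ n)
    (hsmall : (2 * n : ℝ) ^ (-((a - b - 1) / b)) ≤ 1 / 4) :
    ENNReal.ofReal (1 / 4 * (2 * n : ℝ) ^ (-((a - b - 1) / (2 * b)))) ≤
      oscToL2 (mu a b) (P a b ^ n) := by
  have hab' : 1 < a - b := by linarith
  have hprob := isProbabilityMeasure_nu hab'
  have := isMarkovKernel_P ha hb
  have := isMarkovKernel_pow (κ := P a b) n
  have hn1 : (1 : ℝ) ≤ n := by exact_mod_cast hn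
  have hn0 : (0 : ℝ) < n := by linarith
  set t : ℝ := (2 * n : ℝ) ^ (1 / b) with ht
  have hT := measurableSet_tail t
  have hmass : nu (a - b) (tail t) = ENNReal.ofReal ((2 * n : ℝ) ^ (-((a - b - 1) / b))) := by
    rw [nu_tail hab' (Real.one_le_rpow (by linarith) (by positivity)),
      ← Real.rpow_mul (by positivity)]
    congr 2
    ring
  have hp : (nu (a - b)).real (tail t) = (2 * n : ℝ) ^ (-((a - b - 1) / b)) := by
    rw [measureReal_def, hmass, ENNReal.toReal_ofReal (by positivity)]
  have hmem := indicator_sub_mem_unitOsc (μ := nu (a - b)) hT (by rw [hp]; positivity)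
    (by rw [hp]; linarith)
  rw [mu_eq_nu ha hab, oscToL2]
  refine le_trans ?_ (le_iSup₂_of_le _ hmem le_rfl)
  calc ENNReal.ofReal (1 / 4 * (2 * n : ℝ) ^ (-((a - b - 1) / (2 * b))))
      = eLpNorm ((tail t).indicator fun _ => (1 / 4 : ℝ)) 2 (nu (a - b)) := by
        rw [eLpNorm_indicator_const hT two_ne_zero ENNReal.ofNat_ne_top, hmass,
          Real.enorm_eq_ofReal (by norm_num), ENNReal.toReal_ofNat,
          ENNReal.ofReal_rpow_of_nonneg (by positivity) (by norm_num),
          ← ENNReal.ofReal_mul (by norm_num), ← Real.rpow_mul (by positivity)]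
        congr 3
        field_simp
    _ ≤ _ := by
        refine eLpNorm_mono fun x => ?_
        by_cases hx : x ∈ tail t
        · have h1 := half_le_one_sub_w_pow hb hn hx
          have h2 := pow_le_iter_indicator ha hb hT n hx
          have h3 : ∫ y, ((tail t).indicator (fun _ => (1 : ℝ)) y - (nu (a - b)).real (tail t))
              ∂((P a b ^ n) x) = iter a b ((tail t).indicator fun _ => 1) n x -
                (nu (a - b)).real (tail t) := by
            rw [integral_sub ((integrable_const _).indicator hT) (integrable_const _), iter]
            simp
          rw [Set.indicator_of_mem hx, h3, hp, Real.norm_of_nonneg (by norm_num)]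
          exact le_trans (by linarith) (le_abs_self _)
        · rw [Set.indicator_of_notMem hx, norm_zero]
          exact norm_nonneg _

theorem le_of_iSup_rpow_mul_oscToL2_lt_top (ha : 1 < a) (hb : 0 < b) (hab : b < a - 1) {s : ℝ}
    (hfin : (⨆ n : ℕ, ⨆ _ : 1 ≤ n,
      ENNReal.ofReal ((n : ℝ) ^ s) * oscToL2 (mu a b) (P a b ^ n)) < ∞) :
    s ≤ (a - b - 1) / (2 * b) := by
  by_contra! hs
  set ρ := (a - b - 1) / (2 * b) with hρ
  set M := ⨆ n : ℕ, ⨆ _ : 1 ≤ n,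
    ENNReal.ofReal ((n : ℝ) ^ s) * oscToL2 (mu a b) (P a b ^ n) with hM
  have htwo : Tendsto (fun n : ℕ => (2 * n : ℝ)) atTop atTop :=
    tendsto_natCast_atTop_atTop.const_mul_atTop two_pos
  have hsmall : ∀ᶠ n : ℕ in atTop, (2 * n : ℝ) ^ (-((a - b - 1) / b)) ≤ 1 / 4 :=
    ((tendsto_rpow_neg_atTop (div_pos (by linarith) hb)).comp htwo).eventually_le_const
      (by norm_num)
  have hgrow : Tendsto (fun n : ℕ => 1 / 4 * (2 : ℝ) ^ (-ρ) * (n : ℝ) ^ (s - ρ)) atTop atTop :=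
    ((tendsto_rpow_atTop (sub_pos.2 hs)).comp tendsto_natCast_atTop_atTop).const_mul_atTop
      (by positivity)
  obtain ⟨n, hn1, hn2, hn3⟩ := ((eventually_ge_atTop 1).and
    (hsmall.and (hgrow.eventually_gt_atTop M.toReal))).exists
  have hn0 : (0 : ℝ) < n := by exact_mod_cast hn1
  have hle : ENNReal.ofReal (1 / 4 * (2 : ℝ) ^ (-ρ) * (n : ℝ) ^ (s - ρ)) ≤ M := by
    calc _ = ENNReal.ofReal ((n : ℝ) ^ s) * ENNReal.ofReal (1 / 4 * (2 * n : ℝ) ^ (-ρ)) := by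
          rw [← ENNReal.ofReal_mul (by positivity), Real.mul_rpow zero_le_two hn0.le,
            sub_eq_add_neg s, Real.rpow_add hn0]
          congr 1
          ring
      _ ≤ ENNReal.ofReal ((n : ℝ) ^ s) * oscToL2 (mu a b) (P a b ^ n) := by
          gcongr
          exact le_oscToL2 ha hb hab hn1 hn2
      _ ≤ M := le_iSup₂_of_le n hn1 le_rfl
  exact absurd ((ENNReal.ofReal_le_iff_le_toReal hfin.ne).1 hle) hn3.not_ge

end Rates
end ParetoChain

theorem mainTheorem11 (a b : ℝ) (ha : 1 < a) (hb : b ∈ Set.Ioo 0 (a - 1)) :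
    IsProbabilityMeasure (ParetoChain.nu a) ∧
    IsMarkovKernel (ParetoChain.P a b) ∧
    IsProbabilityMeasure (ParetoChain.mu a b) ∧
    ParetoChain.mu a b = ParetoChain.lebesgue.withDensity
      (fun x => ENNReal.ofReal ((a - b - 1) / (x : ℝ) ^ (a - b))) ∧
    (ParetoChain.P a b).IsReversible (ParetoChain.mu a b) ∧
    (∀ s : ℝ, s < (a - b - 1) / b → ∀ x : ParetoChain.E,
      Tendsto (fun n : ℕ => ENNReal.ofReal ((n : ℝ) ^ s) *
        ParetoChain.tvDist ((ParetoChain.P a b ^ n) x) (ParetoChain.mu a b)) atTop (𝓝 0)) ∧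
    (∀ s : ℝ,
      (⨆ n : ℕ, ⨆ _ : 1 ≤ n, ENNReal.ofReal ((n : ℝ) ^ s) *
        ParetoChain.oscToL2 (ParetoChain.mu a b) (ParetoChain.P a b ^ n)) < ∞ ↔
      s ≤ (a - b - 1) / (2 * b)) := by
  obtain ⟨hb0, hab⟩ := hb
  have hmu := ParetoChain.mu_eq_nu ha hab
  refine ⟨ParetoChain.isProbabilityMeasure_nu ha, ParetoChain.isMarkovKernel_P ha hb0, ?_, hmu,
    ParetoChain.isReversible_P a b,
    fun s hs x => ParetoChain.tendsto_rpow_mul_tvDist ha hb0 hab hs x,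
    fun s => ⟨ParetoChain.le_of_iSup_rpow_mul_oscToL2_lt_top ha hb0 hab,
      ParetoChain.iSup_rpow_mul_oscToL2_lt_top ha hb0 hab⟩⟩
  rw [hmu]
  exact ParetoChain.isProbabilityMeasure_nu (by linarith)
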